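/- Let $G=(V,E)$ be a finite simple graph. **Zero forcing.** If $B$ is the set of blue vertices of a graph and all others are white, a blue vertex $u$ forces (turns blue) a white vertex $v$ when $v$ is the only white neighbour of $u$. For $S\subseteq V(H)$ let $\mathsf{White}(S,H)$ be the set of vertices of $H$ that remain white when this rule is applied, starting from the blue set $S$, until no vertex can change. $S$ is a zero forcing set of $H$ if $\mathsf{White}(S,H)=\emptyset$, and $Z(H)$ is the minimum size of a zero forcing set. For a zero forcing set $S$ of $H$, $\mathsf{FAS}(S,H)$ denotes a set of arcs $(u,v)$ recording which vertex $u$ forces which vertex $v$ in some run of the process from $S$ that turns all of $H$ blue and in which each white vertex is forced by exactly one vertex. A fort is a non-empty set $W\subseteq V$ such that no vertex of $V\setminus W$ has exactly one neighbour in $W$; a fort packing is a collection of mutually disjoint forts. **Path decompositions.** A path decomposition of $G$ is a sequence $X_1,\dots,X_k\subseteq V$ that covers all vertices, such that each edge is contained in some $X_i$ and $v\in X_i\cap X_j$, $i<j$, implies $v\in X_s$ for all $i\le s\le j$. Its width is $\max_i|X_i|-1$, and $\mathrm{pw}(G)$ is the least width of a path decomposition of $G$. With $X_0=X_{k+1}=\emptyset$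 it is nice if $X_1,\dots,X_k$ are non-empty and, for $0\le i\le k$, $X_{i+1}$ arises from $X_i$ by adding or by removing exactly one vertex. Put $X_i^j=X_i\cup\dots\cup X_j$ and $G(i,j)=G[X_i^j]$. **Algorithm.** Input: $G$ and a nice path decomposition $X_0,\dots,X_{k+1}$ of $G$. 1. $t\leftarrow 0$, $S\leftarrow\emptyset$, $A\leftarrow\emptyset$, $\mathcal F\leftarrow\emptyset$. 2. $z\leftarrow t$, $W\leftarrow\emptyset$. 3. While $W=\emptyset$ and $z\le k$: $z\leftarrow z+1$, then $W\leftarrow\mathsf{White}(X_t\cup X_z,\,G(t,z))$. 4. Reverse all arcs of $A$. 5. Let $S$ be the set of vertices of $X_0^t$ that are not the head of an arc of $A$. 6. If $W\ne\emptyset$: add $W$ to $\mathcal F$; $S\leftarrow S\cup X_{z-1}$; $A'\leftarrow A\cup\mathsf{FAS}(X_t\cup X_{z-1},\,G(t,z))$; $A\leftarrow\{(u,v)\in A': v\notin X_z\}$; $t\leftarrow z$; go to 2. 7. If $W=\emptyset$: $A\leftarrow A\cup\mathsf{FAS}(X_t,\,G(t,z))$. 8. Return $S$ and $\mathcal F$.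 **Theorem.** Let $X_0,\dots,X_{k+1}$ be a nice path decomposition of $G$ of width $w$, and run the algorithm on it, with an arbitrary choice of each forcing arc set $\mathsf{FAS}(\cdot,\cdot)$. Then every run terminates, all forcing arc sets that it asks for exist, and for the returned $S$ and $\mathcal F$: $S$ is a zero forcing set of $G$, $\mathcal F$ is a fort packing of $G$, and $$|S|\le (w+1)\,|\mathcal F|.$$ In particular, if $w=\mathrm{pw}(G)$, then $|S|\le(\mathrm{pw}(G)+1)\,Z(G)$. -/

import Mathlib

namespace ZeroForcing

variable {V : Type*} [Fintype V] [DecidableEq V]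

/-- The colour change rule in the induced subgraph `G[U]`: with `B` the set of blue vertices
(`B ⊆ U`), the blue vertex `u` forces the white vertex `v`, which is the only white neighbour of
`u` in `G[U]`. -/
def Forces (G : SimpleGraph V) (U B : Finset V) (u v : V) : Prop :=
  u ∈ B ∧ v ∈ U ∧ v ∉ B ∧ G.Adj u v ∧ ∀ x ∈ U, G.Adj u x → x ∉ B → x = v

/-- `ForcingRun G U S B A`: forcing one vertex at a time in `G[U]`, starting from the initial blue
set `S`, one can reach the blue set `B`, and `A` is the set of arcs `(u, v)` such that `u` forced
`v` on the way. -/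
inductive ForcingRun (G : SimpleGraph V) (U S : Finset V) : Finset V → Finset (V × V) → Prop
  | start : ForcingRun G U S S ∅
  | step {B : Finset V} {A : Finset (V × V)} {u v : V} :
      ForcingRun G U S B A → Forces G U B u v →
        ForcingRun G U S (insert v B) (insert (u, v) A)

open Classical in
/-- The vertices of `G[U]` that are white in the derived colouring of `S`, that is, those that
never turn blue. -/
noncomputable def white (G : SimpleGraph V) (U S : Finset V) : Finset V :=
  U.filter fun v => ∀ (B : Finset V) (A : Finset (V × V)), ForcingRun G U S B A → v ∉ B

/-- The forcing arc sets of `G[U]` that represent a zero forcing process with initial blue set `S`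
in which all vertices of `G[U]` turn blue. -/
def forcingArcSets (G : SimpleGraph V) (U S : Finset V) : Set (Finset (V × V)) :=
  {A | ForcingRun G U S U A}

/-- `S` is a zero forcing set of `G`. -/
def IsZeroForcingSet (G : SimpleGraph V) (S : Finset V) : Prop :=
  white G Finset.univ S = ∅

/-- The zero forcing number `Z(G)`. -/
noncomputable def zeroForcingNumber (G : SimpleGraph V) : ℕ :=
  sInf {n | ∃ S : Finset V, IsZeroForcingSet G S ∧ S.card = n}

/-- A fort: a non-empty set of vertices such that no vertex outside has exactly one neighbour
in it. -/
def IsFort (G : SimpleGraph V) (W : Finset V) : Prop :=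
  W.Nonempty ∧ ∀ v, v ∉ W → ¬ ∃! u, u ∈ W ∧ G.Adj v u

/-- A fort packing: a collection of mutually disjoint forts. -/
def IsFortPacking (G : SimpleGraph V) (F : Finset (Finset V)) : Prop :=
  (∀ W ∈ F, IsFort G W) ∧ (F : Set (Finset V)).PairwiseDisjoint id

/-- `X 1, …, X k` is a path decomposition of `G`. (Values of `X` outside `1, …, k` are not
constrained here.) -/
structure IsPathDecomposition (G : SimpleGraph V) (k : ℕ) (X : ℕ → Finset V) : Prop where
  vertex_mem : ∀ v : V, ∃ i, 1 ≤ i ∧ i ≤ k ∧ v ∈ X i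
  edge_mem : ∀ u v : V, G.Adj u v → ∃ i, 1 ≤ i ∧ i ≤ k ∧ u ∈ X i ∧ v ∈ X i
  interval : ∀ (v : V) (i j : ℕ), 1 ≤ i → i < j → j ≤ k → v ∈ X i → v ∈ X j →
    ∀ s, i ≤ s → s ≤ j → v ∈ X s

/-- `X 0, X 1, …, X (k + 1)` is a nice path decomposition of `G`. -/
structure IsNicePathDecomposition (G : SimpleGraph V) (k : ℕ) (X : ℕ → Finset V) : Prop
    extends IsPathDecomposition G k X where
  first_empty : X 0 = ∅
  last_empty : X (k + 1) = ∅
  nonempty : ∀ i, 1 ≤ i → i ≤ k → (X i).Nonempty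
  change : ∀ i, i ≤ k →
    (∃ v, v ∉ X i ∧ X (i + 1) = insert v (X i)) ∨ (∃ v ∈ X i, X (i + 1) = (X i).erase v)

/-- The width `max {|X i| - 1 : 1 ≤ i ≤ k}` of a path decomposition. -/
def width (k : ℕ) (X : ℕ → Finset V) : ℤ :=
  (((Finset.Icc 1 k).sup fun i => (X i).card : ℕ) : ℤ) - 1

/-- The pathwidth of `G`. -/
noncomputable def pathwidth (G : SimpleGraph V) : ℤ :=
  sInf {w | ∃ (k : ℕ) (X : ℕ → Finset V), IsPathDecomposition G k X ∧ width k X = w}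

/-- The union `X i ∪ … ∪ X j`. -/
def bagUnion (X : ℕ → Finset V) (i j : ℕ) : Finset V :=
  (Finset.Icc i j).biUnion X

/-- The reverse of an arc set. -/
def reverse (A : Finset (V × V)) : Finset (V × V) :=
  A.image Prod.swap

/-- The sources (vertices of in-degree zero) of the digraph with vertex set `U` and arc set `A`. -/
def sources (A : Finset (V × V)) (U : Finset V) : Finset V :=
  U.filter fun v => v ∉ A.image Prod.snd

/-- The positions in the program: initialization of the search for the next index, the while loop,
reversal of the arc set, the final case distinction, and the end of the program. -/
inductive Line
  | search
  | loop
  | rev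
  | cases
  | halt

/-- A configuration of the algorithm: the position in the program and the values of its
variables. -/
structure State (V : Type*) where
  line : Line
  t : ℕ
  z : ℕ
  W : Finset V
  S : Finset V
  A : Finset (V × V)
  F : Finset (Finset V)

/-- The configuration after the initialization `t ← 0, S ← ∅, A ← ∅, F ← ∅`. -/
def initial (V : Type*) : State V :=
  ⟨.search, 0, 0, ∅, ∅, ∅, ∅⟩

/-- One step of the zero forcing set algorithm on the input `G` and `X 0, …, X (k + 1)`. Wherever
the algorithm asks for a forcing arc set of some initial blue set, every representative is
allowed. -/
inductive Step (G : SimpleGraph V) (k : ℕ) (X : ℕ → Finset V) : State V → State V → Prop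
  /-- Set `z ← t`, `W ← ∅`. -/
  | search (t z W S A F) :
      Step G k X ⟨.search, t, z, W, S, A, F⟩ ⟨.loop, t, t, ∅, S, A, F⟩
  /-- While `W = ∅` and `z ≤ k`: set `z ← z + 1`, then `W ← White(X t ∪ X z, G(t, z))`. -/
  | loop_body (t z W S A F) (hW : W = ∅) (hz : z ≤ k) :
      Step G k X ⟨.loop, t, z, W, S, A, F⟩
        ⟨.loop, t, z + 1, white G (bagUnion X t (z + 1)) (X t ∪ X (z + 1)), S, A, F⟩
  /-- Leave the while loop. -/
  | loop_exit (t z W S A F) (h : ¬ (W = ∅ ∧ z ≤ k)) :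
      Step G k X ⟨.loop, t, z, W, S, A, F⟩ ⟨.rev, t, z, W, S, A, F⟩
  /-- Reverse `A`, then set `S ← Sources(A, X 0 ∪ … ∪ X t)`. -/
  | rev (t z W S A F) :
      Step G k X ⟨.rev, t, z, W, S, A, F⟩
        ⟨.cases, t, z, W, sources (reverse A) (bagUnion X 0 t), reverse A, F⟩
  /-- If `W ≠ ∅`: add `W` to `F`, set `S ← S ∪ X (z - 1)`, merge `A` with a forcing arc set of
  `G(t, z)` for the initial blue set `X t ∪ X (z - 1)`, remove the arcs with head in `X z`, set
  `t ← z` and start the next search. -/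
  | extend (t z W S A F) (hW : W ≠ ∅) (A₁ : Finset (V × V))
      (hA₁ : A₁ ∈ forcingArcSets G (bagUnion X t z) (X t ∪ X (z - 1))) :
      Step G k X ⟨.cases, t, z, W, S, A, F⟩
        ⟨.search, z, z, W, S ∪ X (z - 1), (A ∪ A₁).filter (fun a => a.2 ∉ X z), insert W F⟩
  /-- If `W = ∅`: merge `A` with a forcing arc set of `G(t, z)` for the initial blue set `X t`,
  and stop. -/
  | finish (t z W S A F) (hW : W = ∅) (A₁ : Finset (V × V))
      (hA₁ : A₁ ∈ forcingArcSets G (bagUnion X t z) (X t)) :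
      Step G k X ⟨.cases, t, z, W, S, A, F⟩ ⟨.halt, t, z, W, S, A ∪ A₁, F⟩

/-- The configuration `s` occurs in some run of the algorithm. -/
def Reachable (G : SimpleGraph V) (k : ℕ) (X : ℕ → Finset V) (s : State V) : Prop :=
  Relation.ReflTransGen (Step G k X) (initial V) s

/-- Every run of the algorithm terminates regularly: there is no infinite run, and no run gets
stuck before the end of the program. -/
def AlwaysHalts (G : SimpleGraph V) (k : ℕ) (X : ℕ → Finset V) : Prop :=
  (¬ ∃ r : ℕ → State V, r 0 = initial V ∧ ∀ n, Step G k X (r n) (r (n + 1))) ∧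
    ∀ s, Reachable G k X s → s.line ≠ .halt → ∃ s', Step G k X s s'

/-- Some run of the algorithm returns the pair `S`, `F`. -/
def Returns (G : SimpleGraph V) (k : ℕ) (X : ℕ → Finset V)
    (S : Finset V) (F : Finset (Finset V)) : Prop :=
  ∃ s, Reachable G k X s ∧ s.line = .halt ∧ s.S = S ∧ s.F = F

end ZeroForcing

namespace ZeroForcing

variable {V : Type*} [DecidableEq V] {G : SimpleGraph V}

/-! ### Forcing runs -/

/-! The algorithm cuts the decomposition at bags `X t`; a round from `t` to `z` yields one fort and
at most `w + 1` new vertices of `S`.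

Forts: the white remainder `W` of `G(t, z)` avoids `X t` and `X z`, so all its neighbours lie in
`G(t, z)` and `W` is a fort of `G` (`isFort_white`). Different segments overlap only in bags that
the forts avoid, so the forts are disjoint.

Zero forcing: arcs form chains, and reversing them gives another forcing process with equally many
sources (`exists_reverse`, `card_sources_reverse`). No head lies in `X t`, so after reversal no
forcing vertex does; forcing vertices then have all their neighbours in `G(0, t)`. The reversed
process thus runs first, turns `X t` blue, and the process of the next segment follows
(`exists_union`).

Size: a search with `W ≠ ∅` ends at the removal of a vertex, so `X z ⊆ X (z - 1)`. Deleting arcs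
into `X z` then creates new sources only in `X (z - 1)`.

Finally, every zero forcing set meets every fort, so `F.card ≤ Z(G)`. -/

/-- `r` orders the arcs of `A` compatibly with the colour change rule in `G[U]`: when the arc
`(u, v)` is used, `u` and all its neighbours other than `v` have smaller rank than `v`. -/
structure IsForcingRank (G : SimpleGraph V) (U : Finset V) (A : Finset (V × V)) (r : V → ℕ) :
    Prop where
  left_mem : ∀ {u v}, (u, v) ∈ A → u ∈ U
  right_mem : ∀ {u v}, (u, v) ∈ A → v ∈ U
  adj : ∀ {u v}, (u, v) ∈ A → G.Adj u v
  lt : ∀ {u v}, (u, v) ∈ A → r u < r v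
  neighbor_lt : ∀ {u v x}, (u, v) ∈ A → x ∈ U → G.Adj u x → x ≠ v → r x < r v
  left_unique : ∀ {u u' v}, (u, v) ∈ A → (u', v) ∈ A → u = u'

theorem mem_sources {A : Finset (V × V)} {U : Finset V} {v : V} :
    v ∈ sources A U ↔ v ∈ U ∧ ∀ u, (u, v) ∉ A := by
  simp [sources]

theorem mem_reverse {A : Finset (V × V)} {u v : V} : (u, v) ∈ reverse A ↔ (v, u) ∈ A := by
  simp [reverse]

namespace ForcingRun

variable {U S B : Finset V} {A : Finset (V × V)}

theorem start_subset (h : ForcingRun G U S B A) : S ⊆ B := by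
  induction h with
  | start => exact subset_rfl
  | step _ _ ih => exact ih.trans (Finset.subset_insert _ _)

theorem subset (h : ForcingRun G U S B A) (hS : S ⊆ U) : B ⊆ U := by
  induction h with
  | start => exact hS
  | step _ hf ih => exact Finset.insert_subset hf.2.1 ih

theorem mem_iff (h : ForcingRun G U S B A) (v : V) : v ∈ B ↔ v ∈ S ∨ ∃ u, (u, v) ∈ A := by
  induction h with
  | start => simp
  | @step B A a b _ hf ih =>
    simp only [Finset.mem_insert, Prod.mk.injEq, ih]
    constructor
    · rintro (rfl | h | ⟨u, h⟩)
      · exact Or.inr ⟨a, Or.inl ⟨rfl, rfl⟩⟩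
      · exact Or.inl h
      · exact Or.inr ⟨u, Or.inr h⟩
    · rintro (h | ⟨u, ⟨-, rfl⟩ | h⟩)
      · exact Or.inr (Or.inl h)
      · exact Or.inl rfl
      · exact Or.inr (Or.inr ⟨u, h⟩)

theorem head_notMem (h : ForcingRun G U S B A) {u v : V} (huv : (u, v) ∈ A) : v ∉ S := by
  induction h with
  | start => simp at huv
  | step hr hf ih =>
    rcases Finset.mem_insert.1 huv with h | h
    · obtain ⟨rfl, rfl⟩ := Prod.mk.inj h
      exact fun hv => hf.2.2.1 (hr.start_subset hv)
    · exact ih h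

/-- No run leads out of a stalled colouring. -/
theorem subset_of_stalled (h : ForcingRun G U S B A) {C : Finset V} (hS : S ⊆ C)
    (hC : ∀ u v, ¬ Forces G U C u v) : B ⊆ C := by
  induction h with
  | start => exact hS
  | @step B A u v _ hf ih =>
    refine Finset.insert_subset ?_ ih
    by_contra hv
    exact hC u v ⟨ih hf.1, hf.2.1, hv, hf.2.2.2.1,
      fun x hx hux hxC => hf.2.2.2.2 x hx hux fun hxB => hxC (ih hxB)⟩

/-- The vertex `w` may have neighbours in `U`; being blue from the start, it never blocks a force.
-/
theorem insert_isolated (h : ForcingRun G U S B A) {w : V} (hw : w ∉ U) :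
    ForcingRun G (insert w U) (insert w S) (insert w B) A := by
  induction h with
  | start => exact .start
  | @step B A u v _ hf ih =>
    rw [Finset.insert_comm]
    refine .step ih ⟨Finset.mem_insert_of_mem hf.1, Finset.mem_insert_of_mem hf.2.1, ?_,
      hf.2.2.2.1, ?_⟩
    · rw [Finset.mem_insert, not_or]
      exact ⟨fun h => hw (h ▸ hf.2.1), hf.2.2.1⟩
    · intro x hx hux hxB
      rw [Finset.mem_insert, not_or] at hxB
      exact hf.2.2.2.2 x ((Finset.mem_insert.1 hx).resolve_left hxB.1) hux hxB.2

/-- Vertices are ranked by the order in which they turn blue. The second conjunct keeps the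
induction going: earlier arcs only concern vertices in `B`, so ranking the new vertex does not
disturb them. -/
theorem exists_rank_aux (h : ForcingRun G U S B A) (hS : S ⊆ U) :
    ∃ r, IsForcingRank G U A r ∧ ∀ u v, (u, v) ∈ A → u ∈ B ∧ v ∈ B ∧
      ∀ x ∈ U, G.Adj u x → x ∈ B := by
  induction h with
  | start => exact ⟨fun _ => 0, by constructor <;> simp, by simp⟩
  | @step B A a b hr hf ih =>
    obtain ⟨r, hrk, hB⟩ := ih
    obtain ⟨ha, hbU, hbB, hab, hx⟩ := hf
    have hne : ∀ {x}, x ∈ B → x ≠ b := fun hx h => hbB (h ▸ hx)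
    have hlt : ∀ x ∈ B, r x < B.sup r + 1 := fun x hx => Nat.lt_succ_of_le (Finset.le_sup hx)
    refine ⟨Function.update r b (B.sup r + 1), ⟨?_, ?_, ?_, ?_, ?_, ?_⟩, ?_⟩
    · intro u v huv
      rcases Finset.mem_insert.1 huv with h | h
      · obtain ⟨rfl, rfl⟩ := Prod.mk.inj h
        exact hr.subset hS ha
      · exact hrk.left_mem h
    · intro u v huv
      rcases Finset.mem_insert.1 huv with h | h
      · obtain ⟨rfl, rfl⟩ := Prod.mk.inj h
        exact hbU
      · exact hrk.right_mem h
    · intro u v huv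
      rcases Finset.mem_insert.1 huv with h | h
      · obtain ⟨rfl, rfl⟩ := Prod.mk.inj h
        exact hab
      · exact hrk.adj h
    · intro u v huv
      rcases Finset.mem_insert.1 huv with h | h
      · obtain ⟨rfl, rfl⟩ := Prod.mk.inj h
        rw [Function.update_self, Function.update_of_ne hab.ne]
        exact hlt _ ha
      · rw [Function.update_of_ne (hne (hB u v h).1), Function.update_of_ne (hne (hB u v h).2.1)]
        exact hrk.lt h
    · intro u v x huv hxU hux hxv
      rcases Finset.mem_insert.1 huv with h | h
      · obtain ⟨rfl, rfl⟩ := Prod.mk.inj h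
        rw [Function.update_self, Function.update_of_ne hxv]
        exact hlt _ (by_contra fun hxB => hxv (hx x hxU hux hxB))
      · rw [Function.update_of_ne (hne (hB u v h).2.1),
          Function.update_of_ne (hne ((hB u v h).2.2 x hxU hux))]
        exact hrk.neighbor_lt h hxU hux hxv
    · intro u u' v huv huv'
      rcases Finset.mem_insert.1 huv with h | h <;> rcases Finset.mem_insert.1 huv' with h' | h'
      · rw [(Prod.mk.inj h).1, (Prod.mk.inj h').1]
      · exact absurd (Prod.mk.inj h).2 (hne (hB _ _ h').2.1)
      · exact absurd (Prod.mk.inj h').2 (hne (hB _ _ h).2.1)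
      · exact hrk.left_unique h h'
    · intro u v huv
      rcases Finset.mem_insert.1 huv with h | h
      · obtain ⟨rfl, rfl⟩ := Prod.mk.inj h
        refine ⟨Finset.mem_insert_of_mem ha, Finset.mem_insert_self _ _, fun x hxU hux => ?_⟩
        by_cases hxB : x ∈ B
        · exact Finset.mem_insert_of_mem hxB
        · exact hx x hxU hux hxB ▸ Finset.mem_insert_self _ _
      · obtain ⟨h1, h2, h3⟩ := hB u v h
        exact ⟨Finset.mem_insert_of_mem h1, Finset.mem_insert_of_mem h2,
          fun x hxU hux => Finset.mem_insert_of_mem (h3 x hxU hux)⟩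

theorem exists_rank (h : ForcingRun G U S B A) (hS : S ⊆ U) : ∃ r, IsForcingRank G U A r :=
  let ⟨r, hr, _⟩ := h.exists_rank_aux hS
  ⟨r, hr⟩

end ForcingRun

/-! ### Reversal, realisation and concatenation of forcing arc sets -/

namespace IsForcingRank

variable {U : Finset V} {A : Finset (V × V)} {r : V → ℕ}

theorem mono (h : IsForcingRank G U A r) {A' : Finset (V × V)} (hA : A' ⊆ A) :
    IsForcingRank G U A' r where
  left_mem he := h.left_mem (hA he)
  right_mem he := h.right_mem (hA he)
  adj he := h.adj (hA he)
  lt he := h.lt (hA he)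
  neighbor_lt he := h.neighbor_lt (hA he)
  left_unique he he' := h.left_unique (hA he) (hA he')

/-- If `u` forced two vertices, each would have to precede the other. -/
theorem right_unique (h : IsForcingRank G U A r) {u v v' : V} (hv : (u, v) ∈ A)
    (hv' : (u, v') ∈ A) : v = v' := by
  by_contra hne
  have h1 := h.neighbor_lt hv (h.right_mem hv') (h.adj hv') (Ne.symm hne)
  have h2 := h.neighbor_lt hv' (h.right_mem hv) (h.adj hv) hne
  omega

theorem card_sources_add (h : IsForcingRank G U A r) :
    (sources A U).card + A.card = U.card := by
  have hs : sources A U = U \ A.image Prod.snd := by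
    ext v; simp [sources]
  have hi : (A.image Prod.snd).card = A.card := by
    refine Finset.card_image_of_injOn ?_
    rintro ⟨u, v⟩ hu ⟨u', v'⟩ hu' (rfl : v = v')
    rw [h.left_unique hu hu']
  rw [hs, ← hi]
  refine Finset.card_sdiff_add_card_eq_card ?_
  intro v hv
  obtain ⟨⟨u, v⟩, he, rfl⟩ := Finset.mem_image.1 hv
  exact h.right_mem he

theorem exists_reverse (h : IsForcingRank G U A r) :
    ∃ r', IsForcingRank G U (reverse A) r' := by
  classical
  let N := U.sup r + 1
  have hN : ∀ v ∈ U, r v < N := fun v hv => Nat.lt_succ_of_le (Finset.le_sup hv)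
  -- Time runs backwards: `x` turns blue when its old force `(x, y)` is undone. Ends of chains are
  -- the new initial vertices and get rank `0`, below every `N - r y`.
  let r' : V → ℕ := fun x => if hx : ∃ y, (x, y) ∈ A then N - r hx.choose else 0
  have hr' : ∀ {x y}, (x, y) ∈ A → r' x = N - r y := by
    intro x y hxy
    have hx : ∃ y, (x, y) ∈ A := ⟨y, hxy⟩
    simp only [r', dif_pos hx]
    rw [h.right_unique hx.choose_spec hxy]
  have hr0 : ∀ {x}, (¬ ∃ y, (x, y) ∈ A) → r' x = 0 := fun hx => dif_neg hx
  have key : ∀ {u v x}, (u, v) ∈ A → (∀ y, (x, y) ∈ A → r v < r y) → r' x < r' u := by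
    intro u v x huv hx
    have := hN v (h.right_mem huv)
    rw [hr' huv]
    by_cases hxy : ∃ y, (x, y) ∈ A
    · obtain ⟨y, hxy⟩ := hxy
      rw [hr' hxy]
      have := hx y hxy
      omega
    · rw [hr0 hxy]
      omega
  refine ⟨r', ⟨fun he => h.right_mem (mem_reverse.1 he), fun he => h.left_mem (mem_reverse.1 he),
    fun he => (h.adj (mem_reverse.1 he)).symm, fun he => ?_, fun {v u x} he hx hvx hxu => ?_,
    fun he he' => h.right_unique (mem_reverse.1 he) (mem_reverse.1 he')⟩⟩
  · exact key (mem_reverse.1 he) fun y hy => h.lt hy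
  · rw [mem_reverse] at he
    refine key he fun y hy => h.neighbor_lt hy (h.right_mem he) hvx.symm ?_
    rintro rfl
    exact hxu (h.left_unique hy he)

theorem card_sources_reverse (h : IsForcingRank G U A r) :
    (sources (reverse A) U).card = (sources A U).card := by
  obtain ⟨r', h'⟩ := h.exists_reverse
  have hc : (reverse A).card = A.card := Finset.card_image_of_injective _ Prod.swap_injective
  have h1 := h.card_sources_add
  have h2 := h'.card_sources_add
  omega

/-- An unused arc whose head has least rank can always be applied next, since every vertex of
smaller rank is already blue. -/
theorem forcingRun (h : IsForcingRank G U A r) : ForcingRun G U (sources A U) U A := by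
  have key : ∀ n, ∀ A' ⊆ A, (A \ A').card = n → ∀ B, ForcingRun G U (sources A U) B A' →
      ForcingRun G U (sources A U) U A := by
    intro n
    induction n with
    | zero =>
      intro A' hA' hc B hB
      obtain rfl : A' = A := hA'.antisymm (by simpa using hc)
      have : B = U := by
        refine (hB.subset (Finset.filter_subset _ _)).antisymm fun v hv => ?_
        rw [hB.mem_iff, mem_sources]
        by_cases hv' : ∃ u, (u, v) ∈ A'
        · exact Or.inr hv'
        · exact Or.inl ⟨hv, not_exists.1 hv'⟩
      exact this ▸ hB
    | succ n ih =>
      intro A' hA' hc B hB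
      obtain ⟨⟨u, v⟩, he, hmin⟩ := Finset.exists_min_image (A \ A') (fun e => r e.2)
        (Finset.card_pos.1 (by omega))
      obtain ⟨heA, heA'⟩ := Finset.mem_sdiff.1 he
      have hblue : ∀ x ∈ U, r x < r v → x ∈ B := by
        intro x hxU hx
        rw [hB.mem_iff, mem_sources]
        by_cases hx' : ∃ w, (w, x) ∈ A
        · obtain ⟨w, hw⟩ := hx'
          refine Or.inr ⟨w, by_contra fun hw' => ?_⟩
          have := hmin (w, x) (Finset.mem_sdiff.2 ⟨hw, hw'⟩)
          simp only at this
          omega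
        · exact Or.inl ⟨hxU, not_exists.1 hx'⟩
      have hvB : v ∉ B := by
        rw [hB.mem_iff, mem_sources]
        rintro (⟨-, hv⟩ | ⟨w, hw⟩)
        · exact hv u heA
        · exact heA' (h.left_unique heA (hA' hw) ▸ hw)
      refine ih (insert (u, v) A') (Finset.insert_subset heA hA') ?_ _
        (hB.step ⟨hblue u (h.left_mem heA) (h.lt heA), h.right_mem heA, hvB, h.adj heA,
          fun x hx hux hxB => by_contra fun hxv => hxB (hblue x hx (h.neighbor_lt heA hx hux hxv))⟩)
      rw [Finset.sdiff_insert, Finset.card_erase_of_mem he, hc, Nat.add_sub_cancel]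
  exact key _ ∅ (Finset.empty_subset _) rfl _ .start

/-- Two forcing processes can be carried out one after the other, when no vertex that forces in the
first one has a neighbour outside of the first graph. -/
theorem exists_union {U₁ A₁} {r₁ : V → ℕ} (h : IsForcingRank G U A r)
    (h₁ : IsForcingRank G U₁ A₁ r₁) (hA : ∀ {u v x}, (u, v) ∈ A → G.Adj u x → x ∈ U)
    (hA₁ : ∀ {u v}, (u, v) ∈ A₁ → v ∉ U) :
    ∃ r', IsForcingRank G (U ∪ U₁) (A ∪ A₁) r' := by
  let N := U.sup r + 1
  have hN : ∀ v ∈ U, r v < N := fun v hv => Nat.lt_succ_of_le (Finset.le_sup hv)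
  -- The offset `N` places all of `U` before every vertex outside `U`, hence before every head of
  -- `A₁`.
  let r' : V → ℕ := fun x => if x ∈ U then r x else N + r₁ x
  have hin : ∀ {x}, x ∈ U → r' x = r x := fun hx => if_pos hx
  have hout : ∀ {x}, x ∉ U → r' x = N + r₁ x := fun hx => if_neg hx
  have hlt : ∀ {x y}, y ∉ U → (x ∉ U → r₁ x < r₁ y) → r' x < r' y := by
    intro x y hy hxy
    rw [hout hy]
    by_cases hx : x ∈ U
    · rw [hin hx]
      have := hN x hx
      omega
    · rw [hout hx]
      have := hxy hx
      omega
  refine ⟨r', ⟨?_, ?_, ?_, ?_, ?_, ?_⟩⟩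
  · intro u v he
    rcases Finset.mem_union.1 he with he | he
    · exact Finset.mem_union_left _ (h.left_mem he)
    · exact Finset.mem_union_right _ (h₁.left_mem he)
  · intro u v he
    rcases Finset.mem_union.1 he with he | he
    · exact Finset.mem_union_left _ (h.right_mem he)
    · exact Finset.mem_union_right _ (h₁.right_mem he)
  · intro u v he
    rcases Finset.mem_union.1 he with he | he
    · exact h.adj he
    · exact h₁.adj he
  · intro u v he
    rcases Finset.mem_union.1 he with he | he
    · rw [hin (h.left_mem he), hin (h.right_mem he)]
      exact h.lt he
    · exact hlt (hA₁ he) fun _ => h₁.lt he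
  · intro u v x he hx hux hxv
    rcases Finset.mem_union.1 he with he | he
    · rw [hin (hA he hux), hin (h.right_mem he)]
      exact h.neighbor_lt he (hA he hux) hux hxv
    · exact hlt (hA₁ he) fun hxU =>
        h₁.neighbor_lt he ((Finset.mem_union.1 hx).resolve_left hxU) hux hxv
  · intro u u' v he he'
    rcases Finset.mem_union.1 he with he | he <;> rcases Finset.mem_union.1 he' with he' | he'
    · exact h.left_unique he he'
    · exact absurd (h.right_mem he) (hA₁ he')
    · exact absurd (h.right_mem he') (hA₁ he)
    · exact h₁.left_unique he he'

end IsForcingRank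

/-! ### Nice path decompositions -/

variable {k : ℕ} {X : ℕ → Finset V}

theorem mem_bagUnion {i j : ℕ} {v : V} :
    v ∈ bagUnion X i j ↔ ∃ s, i ≤ s ∧ s ≤ j ∧ v ∈ X s := by
  simp [bagUnion, and_assoc]

theorem bag_subset_bagUnion {i j s : ℕ} (hi : i ≤ s) (hj : s ≤ j) : X s ⊆ bagUnion X i j :=
  fun _ hv => mem_bagUnion.2 ⟨s, hi, hj, hv⟩

theorem union_bags_subset_bagUnion {t z : ℕ} (h : t ≤ z) : X t ∪ X z ⊆ bagUnion X t z :=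
  Finset.union_subset (bag_subset_bagUnion le_rfl h) (bag_subset_bagUnion h le_rfl)

theorem bagUnion_self (X : ℕ → Finset V) (i : ℕ) : bagUnion X i i = X i := by
  simp [bagUnion]

theorem bagUnion_succ {i j : ℕ} (h : i ≤ j) :
    bagUnion X i (j + 1) = bagUnion X i j ∪ X (j + 1) := by
  ext v
  simp only [Finset.mem_union, mem_bagUnion]
  constructor
  · rintro ⟨s, h1, h2, h3⟩
    rcases h2.lt_or_eq with h2 | rfl
    · exact Or.inl ⟨s, h1, by omega, h3⟩
    · exact Or.inr h3
  · rintro (⟨s, h1, h2, h3⟩ | h3)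
    · exact ⟨s, h1, by omega, h3⟩
    · exact ⟨j + 1, by omega, le_rfl, h3⟩

theorem bagUnion_union {i j l : ℕ} (hij : i ≤ j) (hjl : j ≤ l) :
    bagUnion X i j ∪ bagUnion X j l = bagUnion X i l := by
  ext v
  simp only [Finset.mem_union, mem_bagUnion]
  constructor
  · rintro (⟨s, h1, h2, h3⟩ | ⟨s, h1, h2, h3⟩) <;> exact ⟨s, by omega, by omega, h3⟩
  · rintro ⟨s, h1, h2, h3⟩
    rcases le_total s j with h | h
    · exact Or.inl ⟨s, h1, h, h3⟩
    · exact Or.inr ⟨s, h, h2, h3⟩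

namespace IsNicePathDecomposition

theorem mem_between (hX : IsNicePathDecomposition G k X) {v : V} {i s j : ℕ} (his : i ≤ s)
    (hsj : s ≤ j) (hj : j ≤ k + 1) (hvi : v ∈ X i) (hvj : v ∈ X j) : v ∈ X s := by
  have hi0 : i ≠ 0 := by
    rintro rfl
    simp [hX.first_empty] at hvi
  have hjk : j ≠ k + 1 := by
    rintro rfl
    simp [hX.last_empty] at hvj
  rcases (his.trans hsj).lt_or_eq with h | rfl
  · exact hX.interval v i j (by omega) h (by omega) hvi hvj s his hsj
  · rwa [his.antisymm hsj] at hvi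

/-- The bag `X t` separates what lies to its left from what lies to its right. -/
theorem mem_bag_of_mem_bagUnion (hX : IsNicePathDecomposition G k X) {v : V} {i t j : ℕ}
    (hj : j ≤ k + 1) (hvi : v ∈ bagUnion X i t) (hvj : v ∈ bagUnion X t j) : v ∈ X t := by
  obtain ⟨s, -, hs, hvs⟩ := mem_bagUnion.1 hvi
  obtain ⟨s', hs', hs'j, hvs'⟩ := mem_bagUnion.1 hvj
  exact hX.mem_between hs hs' (by omega) hvs hvs'

/-- If the bag containing the edge lay outside `i, …, j`, the interval property would put `u` into
`X i` or `X j`. -/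
theorem mem_bagUnion_of_adj (hX : IsNicePathDecomposition G k X) {i j : ℕ} (hj : j ≤ k + 1)
    {u x : V} (hu : u ∈ bagUnion X i j) (hui : u ∈ X i → x ∈ bagUnion X i j) (huj : u ∉ X j)
    (hux : G.Adj u x) : x ∈ bagUnion X i j := by
  obtain ⟨s, his, hsj, hus⟩ := mem_bagUnion.1 hu
  obtain ⟨e, -, he, hue, hxe⟩ := hX.edge_mem u x hux
  by_cases hie : i ≤ e
  · refine mem_bagUnion.2 ⟨e, hie, ?_, hxe⟩
    by_contra h
    exact huj (hX.mem_between (i := s) (j := e) hsj (by omega) (by omega) hus hue)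
  · exact hui (hX.mem_between (i := e) (j := s) (by omega) his (by omega) hue hus)

theorem mem_bagUnion_zero_of_adj (hX : IsNicePathDecomposition G k X) {j : ℕ} (hj : j ≤ k + 1)
    {u x : V} (hu : u ∈ bagUnion X 0 j) (huj : u ∉ X j) (hux : G.Adj u x) :
    x ∈ bagUnion X 0 j :=
  hX.mem_bagUnion_of_adj hj hu (fun h => by simp [hX.first_empty] at h) huj hux

theorem bagUnion_eq_univ [Fintype V] (hX : IsNicePathDecomposition G k X) :
    bagUnion X 0 (k + 1) = Finset.univ := by
  refine Finset.eq_univ_of_forall fun v => ?_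
  obtain ⟨i, -, hi, hv⟩ := hX.vertex_mem v
  exact mem_bagUnion.2 ⟨i, Nat.zero_le _, by omega, hv⟩

theorem card_bag_le (hX : IsNicePathDecomposition G k X) {i : ℕ} (hi : i ≤ k + 1) :
    (X i).card ≤ (Finset.Icc 1 k).sup fun i => (X i).card := by
  by_cases h : 1 ≤ i ∧ i ≤ k
  · exact Finset.le_sup (f := fun i => (X i).card) (Finset.mem_Icc.2 h)
  · obtain rfl | rfl : i = 0 ∨ i = k + 1 := by omega
    · simp [hX.first_empty]
    · simp [hX.last_empty]

end IsNicePathDecomposition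

/-! ### Derived colourings, forts and the zero forcing number -/

variable [Fintype V]

theorem mem_white {U S : Finset V} {v : V} :
    v ∈ white G U S ↔ v ∈ U ∧ ∀ B A, ForcingRun G U S B A → v ∉ B := by
  simp [white]

/-- A run with the largest blue set is stalled, and a stalled colouring contains the blue set of
every run. -/
theorem exists_stalled_run (G : SimpleGraph V) (U S : Finset V) :
    ∃ B A, ForcingRun G U S B A ∧ (∀ u v, ¬ Forces G U B u v) ∧ white G U S = U \ B := by
  obtain ⟨B, ⟨A, hA⟩, hmax⟩ : ∃ B, (∃ A, ForcingRun G U S B A) ∧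
      ∀ C, (∃ A, ForcingRun G U S C A) → C.card ≤ B.card := by
    classical
    obtain ⟨B, hB, hmax⟩ := Finset.exists_max_image
      (Finset.univ.filter fun B : Finset V => ∃ A, ForcingRun G U S B A) Finset.card
      ⟨S, by simpa using ⟨∅, .start⟩⟩
    exact ⟨B, by simpa using hB, fun C hC => hmax C (by simpa using hC)⟩
  have hst : ∀ u v, ¬ Forces G U B u v := by
    intro u v hf
    have := hmax _ ⟨_, hA.step hf⟩
    rw [Finset.card_insert_of_notMem hf.2.2.1] at this
    omega
  refine ⟨B, A, hA, hst, ?_⟩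
  ext v
  rw [mem_white, Finset.mem_sdiff]
  refine and_congr_right fun _ => ⟨fun h => h B A hA, fun h C A' hC hv => ?_⟩
  exact h (hC.subset_of_stalled hA.start_subset hst hv)

theorem white_eq_empty_iff {U S : Finset V} (hS : S ⊆ U) :
    white G U S = ∅ ↔ (forcingArcSets G U S).Nonempty := by
  constructor
  · intro h
    obtain ⟨B, A, hA, -, hw⟩ := exists_stalled_run G U S
    rw [hw, Finset.sdiff_eq_empty_iff_subset] at h
    obtain rfl := (hA.subset hS).antisymm h
    exact ⟨A, hA⟩
  · rintro ⟨A, hA⟩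
    exact Finset.eq_empty_of_forall_notMem fun v hv => (mem_white.1 hv).2 U A hA (mem_white.1 hv).1

theorem white_subset (G : SimpleGraph V) (U S : Finset V) : white G U S ⊆ U :=
  fun _ hv => (mem_white.1 hv).1

theorem notMem_of_mem_white {U S : Finset V} {v : V} (h : v ∈ white G U S) : v ∉ S :=
  (mem_white.1 h).2 S ∅ .start

theorem white_self (G : SimpleGraph V) (U : Finset V) : white G U U = ∅ :=
  (white_eq_empty_iff subset_rfl).2 ⟨∅, .start⟩

/-- By `hcl`, a vertex with a neighbour in the white set lies in `U`; if it were blue with exactly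
one such neighbour, it could still force. -/
theorem isFort_white {U S : Finset V} (hne : (white G U S).Nonempty)
    (hcl : ∀ v ∈ white G U S, ∀ x, G.Adj v x → x ∈ U) : IsFort G (white G U S) := by
  refine ⟨hne, ?_⟩
  obtain ⟨B, A, -, hst, hw⟩ := exists_stalled_run G U S
  rintro v hv ⟨u, ⟨hu, hvu⟩, huniq⟩
  have hvU := hcl u hu v hvu.symm
  rw [hw, Finset.mem_sdiff] at hu hv
  refine hst v u ⟨by_contra fun h => hv ⟨hvU, h⟩, hu.1, hu.2, hvu, fun x hx hvx hxB => ?_⟩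
  exact huniq x ⟨hw ▸ Finset.mem_sdiff.2 ⟨hx, hxB⟩, hvx⟩

/-- The first vertex of `W` to turn blue would be forced from outside, by a vertex with only one
neighbour in `W`. -/
theorem IsFort.inter_nonempty {S W : Finset V} (hW : IsFort G W) (hS : IsZeroForcingSet G S) :
    (S ∩ W).Nonempty := by
  rw [← Finset.not_disjoint_iff_nonempty_inter]
  intro hd
  have key : ∀ B A, ForcingRun G Finset.univ S B A → Disjoint B W := by
    intro B A h
    induction h with
    | start => exact hd
    | @step B A u v _ hf ih =>
      rw [Finset.disjoint_insert_left]
      refine ⟨fun hv => hW.2 u (Finset.disjoint_left.1 ih hf.1) ⟨v, ⟨hv, hf.2.2.2.1⟩, ?_⟩, ih⟩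
      rintro x ⟨hx, hux⟩
      exact hf.2.2.2.2 x (Finset.mem_univ _) hux (Finset.disjoint_right.1 ih hx)
  obtain ⟨w, hw⟩ := hW.1
  have : w ∈ white G Finset.univ S := mem_white.2
    ⟨Finset.mem_univ _, fun B A h => Finset.disjoint_right.1 (key B A h) hw⟩
  rw [show white G Finset.univ S = ∅ from hS] at this
  simp at this

theorem IsFortPacking.card_le {F : Finset (Finset V)} (hF : IsFortPacking G F) {S : Finset V}
    (hS : IsZeroForcingSet G S) : F.card ≤ S.card := by
  have hc : ∀ W ∈ F, (S ∩ W).Nonempty := fun W hW => (hF.1 W hW).inter_nonempty hS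
  rcases F.eq_empty_or_nonempty with rfl | ⟨W₀, hW₀⟩
  · simp
  have : Nonempty V := (hc W₀ hW₀).to_type
  choose! f hf using hc
  refine Finset.card_le_card_of_injOn f (fun W hW => (Finset.mem_inter.1 (hf W hW)).1) ?_
  intro W hW W' hW' hEq
  refine hF.2.elim_finset hW hW' (f W) (Finset.mem_inter.1 (hf W hW)).2 ?_
  exact hEq ▸ (Finset.mem_inter.1 (hf W' hW')).2

theorem IsFortPacking.card_le_zeroForcingNumber {F : Finset (Finset V)} (hF : IsFortPacking G F) :
    F.card ≤ zeroForcingNumber G := by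
  obtain ⟨S, hS, hc⟩ := Nat.sInf_mem
    (s := {n | ∃ S : Finset V, IsZeroForcingSet G S ∧ S.card = n})
    ⟨_, Finset.univ, white_self G _, rfl⟩
  exact (hF.card_le hS).trans hc.le

/-! ### The algorithm -/

/-- The search started at `t` has reached `z`, with the current white set `W`. -/
structure SearchInvariant (G : SimpleGraph V) (k : ℕ) (X : ℕ → Finset V) (t z : ℕ)
    (W : Finset V) : Prop where
  le : t ≤ z
  le_succ : z ≤ k + 1
  white_eq_empty : ∀ y, t ≤ y → y < z → white G (bagUnion X t y) (X t ∪ X y) = ∅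
  white_eq : white G (bagUnion X t z) (X t ∪ X z) = W

/-- `A` is a set of forcing arcs for `G(0, t)` that has no heads in `X t`, and `F` is a fort packing
that avoids `X t` and is large enough. -/
structure PrefixInvariant (G : SimpleGraph V) (k : ℕ) (X : ℕ → Finset V) (t : ℕ)
    (A : Finset (V × V)) (F : Finset (Finset V)) : Prop where
  le_succ : t ≤ k + 1
  exists_rank : ∃ r, IsForcingRank G (bagUnion X 0 t) A r
  head_notMem : ∀ {u v}, (u, v) ∈ A → v ∉ X t
  isFortPacking : IsFortPacking G F
  mem_bagUnion : ∀ W ∈ F, ∀ v ∈ W, v ∈ bagUnion X 0 t ∧ v ∉ X t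
  card_sources_le : (sources A (bagUnion X 0 t)).card ≤
    ((Finset.Icc 1 k).sup fun i => (X i).card) * F.card

theorem SearchInvariant.start {t : ℕ} (ht : t ≤ k + 1) : SearchInvariant G k X t t ∅ where
  le := le_rfl
  le_succ := ht
  white_eq_empty y h1 h2 := by omega
  white_eq := by rw [bagUnion_self, Finset.union_self, white_self]

theorem SearchInvariant.next {t z : ℕ} (h : SearchInvariant G k X t z ∅) (hz : z ≤ k) :
    SearchInvariant G k X t (z + 1)
      (white G (bagUnion X t (z + 1)) (X t ∪ X (z + 1))) where
  le := by have := h.le; omega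
  le_succ := by omega
  white_eq_empty y h1 h2 := by
    rcases (Nat.lt_succ_iff.1 h2).lt_or_eq with h2 | rfl
    · exact h.white_eq_empty y h1 h2
    · exact h.white_eq
  white_eq := rfl

/-- The introduced vertex is new to the segment and belongs to the blue bag `X (y + 1)`, so the old
run still works. -/
theorem IsNicePathDecomposition.white_insert (hX : IsNicePathDecomposition G k X) {t y : ℕ}
    (hty : t ≤ y) (hyk : y ≤ k) {w : V} (hw : w ∉ X y) (hXw : X (y + 1) = insert w (X y))
    (h : white G (bagUnion X t y) (X t ∪ X y) = ∅) :
    white G (bagUnion X t (y + 1)) (X t ∪ X (y + 1)) = ∅ := by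
  have hwU : w ∉ bagUnion X t y := fun hwU => hw <|
    hX.mem_bag_of_mem_bagUnion (j := y + 1) (by omega) hwU
      (bag_subset_bagUnion (by omega) le_rfl (hXw ▸ Finset.mem_insert_self _ _))
  have hU : bagUnion X t (y + 1) = insert w (bagUnion X t y) := by
    rw [bagUnion_succ hty, hXw, Finset.union_insert,
      Finset.union_eq_left.2 (bag_subset_bagUnion hty le_rfl)]
  obtain ⟨A, hA⟩ := (white_eq_empty_iff (union_bags_subset_bagUnion hty)).1 h
  rw [white_eq_empty_iff (union_bags_subset_bagUnion (by omega)), hU, hXw, Finset.union_insert]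
  exact ⟨A, ForcingRun.insert_isolated hA hwU⟩

/-- When the search stops at a non-empty white set, the last step has removed a vertex. -/
theorem SearchInvariant.exists_erase (hX : IsNicePathDecomposition G k X) {t z : ℕ} {W : Finset V}
    (h : SearchInvariant G k X t z W) (hW : W ≠ ∅) :
    t < z ∧ (∃ v ∈ X (z - 1), X z = (X (z - 1)).erase v) ∧
      bagUnion X t z = bagUnion X t (z - 1) := by
  have htz : t < z := by
    refine h.le.lt_of_ne ?_
    rintro rfl
    refine hW ?_
    rw [← h.white_eq, bagUnion_self, Finset.union_self, white_self]
  obtain ⟨y, rfl⟩ : ∃ y, z = y + 1 := ⟨z - 1, by omega⟩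
  have hyk : y ≤ k := by have := h.le_succ; omega
  have hy := h.white_eq_empty y (by omega) (by omega)
  rw [Nat.add_sub_cancel]
  rcases hX.change y hyk with ⟨v, hv, hXv⟩ | ⟨v, hv, hXv⟩
  · exact absurd (h.white_eq.symm.trans (hX.white_insert (by omega) hyk hv hXv hy)) hW
  · refine ⟨htz, ⟨v, hv, hXv⟩, ?_⟩
    rw [bagUnion_succ (by omega), hXv, Finset.union_eq_left]
    exact (Finset.erase_subset _ _).trans (bag_subset_bagUnion (by omega) le_rfl)

theorem SearchInvariant.forcingArcSets_nonempty (hX : IsNicePathDecomposition G k X) {t z : ℕ}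
    {W : Finset V} (h : SearchInvariant G k X t z W) (hW : W ≠ ∅) :
    (forcingArcSets G (bagUnion X t z) (X t ∪ X (z - 1))).Nonempty := by
  obtain ⟨htz, -, hU⟩ := h.exists_erase hX hW
  rw [hU, ← white_eq_empty_iff (union_bags_subset_bagUnion (by omega))]
  exact h.white_eq_empty _ (by omega) (by omega)

theorem SearchInvariant.forcingArcSets_nonempty_of_eq_empty (hX : IsNicePathDecomposition G k X)
    {t : ℕ} (h : SearchInvariant G k X t (k + 1) ∅) :
    (forcingArcSets G (bagUnion X t (k + 1)) (X t)).Nonempty := by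
  rw [← white_eq_empty_iff (bag_subset_bagUnion le_rfl h.le)]
  simpa [hX.last_empty] using h.white_eq

theorem SearchInvariant.isFort (hX : IsNicePathDecomposition G k X) {t z : ℕ} {W : Finset V}
    (h : SearchInvariant G k X t z W) (hW : W ≠ ∅) : IsFort G W := by
  obtain rfl := h.white_eq
  refine isFort_white (Finset.nonempty_iff_ne_empty.2 hW) fun v hv x hvx => ?_
  have hv' := notMem_of_mem_white hv
  rw [Finset.mem_union, not_or] at hv'
  exact hX.mem_bagUnion_of_adj h.le_succ (white_subset _ _ _ hv) (fun hvt => absurd hvt hv'.1)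
    hv'.2 hvx

theorem SearchInvariant.notMem_left {t z : ℕ} {W : Finset V} (h : SearchInvariant G k X t z W)
    {v : V} (hv : v ∈ W) : v ∈ bagUnion X t z ∧ v ∉ X t ∧ v ∉ X z := by
  obtain rfl := h.white_eq
  have hv' := notMem_of_mem_white hv
  rw [Finset.mem_union, not_or] at hv'
  exact ⟨white_subset _ _ _ hv, hv'⟩

/-! ### Extending the prefix by one round -/

theorem PrefixInvariant.start (hX : IsNicePathDecomposition G k X) :
    PrefixInvariant G k X 0 ∅ ∅ where
  le_succ := Nat.zero_le _
  exists_rank := ⟨fun _ => 0, by constructor <;> simp⟩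
  head_notMem := by simp
  isFortPacking := by simp [IsFortPacking]
  mem_bagUnion := by simp
  card_sources_le := by simp [bagUnion_self, hX.first_empty, sources]

/-- The merged arc set is a set of forcing arcs for `G(0, z)`. -/
theorem PrefixInvariant.exists_rank_union (hX : IsNicePathDecomposition G k X) {t z : ℕ}
    {A A₁ : Finset (V × V)} {F : Finset (Finset V)} (h : PrefixInvariant G k X t A F)
    (htz : t ≤ z) (hz : z ≤ k + 1) {S : Finset V} (hS : X t ⊆ S) (hSU : S ⊆ bagUnion X t z)
    (hA₁ : A₁ ∈ forcingArcSets G (bagUnion X t z) S) :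
    (∃ r, IsForcingRank G (bagUnion X 0 z) (reverse A ∪ A₁) r) ∧
      ∀ {u v}, (u, v) ∈ A₁ → v ∉ bagUnion X 0 t := by
  obtain ⟨r, hr⟩ := h.exists_rank
  obtain ⟨r', hr'⟩ := hr.exists_reverse
  obtain ⟨r₁, hr₁⟩ := ForcingRun.exists_rank hA₁ hSU
  -- A head already in the prefix would lie in the separator `X t ⊆ S`, hence be blue from the
  -- start.
  have hnew : ∀ {u v}, (u, v) ∈ A₁ → v ∉ bagUnion X 0 t := fun he hv =>
    ForcingRun.head_notMem hA₁ he <| hS <|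
      hX.mem_bag_of_mem_bagUnion hz hv (hr₁.right_mem he)
  refine ⟨?_, hnew⟩
  rw [← bagUnion_union (Nat.zero_le t) htz]
  refine hr'.exists_union hr₁ (fun he hux => ?_) hnew
  exact hX.mem_bagUnion_zero_of_adj h.le_succ (hr'.left_mem he)
    (h.head_notMem (mem_reverse.1 he)) hux

theorem PrefixInvariant.extend (hX : IsNicePathDecomposition G k X) {t z : ℕ}
    {A A₁ : Finset (V × V)} {W : Finset V} {F : Finset (Finset V)}
    (h : PrefixInvariant G k X t A F) (hs : SearchInvariant G k X t z W) (hW : W ≠ ∅)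
    (hA₁ : A₁ ∈ forcingArcSets G (bagUnion X t z) (X t ∪ X (z - 1))) :
    PrefixInvariant G k X z ((reverse A ∪ A₁).filter fun a => a.2 ∉ X z) (insert W F) := by
  obtain ⟨htz, ⟨w, hw, hXw⟩, hU⟩ := hs.exists_erase hX hW
  have hz := hs.le_succ
  have hSU : X t ∪ X (z - 1) ⊆ bagUnion X t z :=
    hU ▸ union_bags_subset_bagUnion (by omega)
  obtain ⟨⟨r, hr⟩, hnew⟩ :=
    h.exists_rank_union hX htz.le hz Finset.subset_union_left hSU hA₁
  obtain ⟨r₀, hr₀⟩ := h.exists_rank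
  have hsub : bagUnion X 0 t ⊆ bagUnion X 0 z := by
    rw [← bagUnion_union (Nat.zero_le t) htz.le]
    exact Finset.subset_union_left
  have hdisj : ∀ W' ∈ F, Disjoint W W' := fun W' hW' => Finset.disjoint_left.2 fun v hv hv' =>
    (h.mem_bagUnion W' hW' v hv').2 <|
      hX.mem_bag_of_mem_bagUnion hz (h.mem_bagUnion W' hW' v hv').1 (hs.notMem_left hv).1
  have hWF : W ∉ F := fun hWF => hW (Finset.disjoint_self_iff_empty W |>.1 (hdisj W hWF))
  refine ⟨hz, ⟨r, hr.mono (Finset.filter_subset _ _)⟩, fun he => (Finset.mem_filter.1 he).2,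
    ⟨?_, ?_⟩, ?_, ?_⟩
  · intro W' hW'
    rcases Finset.mem_insert.1 hW' with rfl | hW'
    · exact hs.isFort hX hW
    · exact h.isFortPacking.1 W' hW'
  · rw [Finset.coe_insert]
    exact h.isFortPacking.2.insert fun W' hW' _ => hdisj W' hW'
  · intro W' hW' v hv
    rcases Finset.mem_insert.1 hW' with rfl | hW'
    · obtain ⟨h1, -, h3⟩ := hs.notMem_left hv
      refine ⟨?_, h3⟩
      rw [← bagUnion_union (Nat.zero_le t) htz.le]
      exact Finset.mem_union_right _ h1
    · obtain ⟨h1, h2⟩ := h.mem_bagUnion W' hW' v hv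
      refine ⟨hsub h1, fun hvz => h2 ?_⟩
      exact hX.mem_bag_of_mem_bagUnion hz h1 (bag_subset_bagUnion htz.le le_rfl hvz)
  -- A source outside `X (z - 1)` is also outside `X z`, so no arc into it was deleted; it must be
  -- an old source.
  · have hsrc : sources ((reverse A ∪ A₁).filter fun a => a.2 ∉ X z) (bagUnion X 0 z) ⊆
        sources (reverse A) (bagUnion X 0 t) ∪ X (z - 1) := by
      intro v hv
      rw [mem_sources] at hv
      obtain ⟨hvU, hv⟩ := hv
      rw [Finset.mem_union, or_iff_not_imp_right]
      intro hvz
      have hvz' : v ∉ X z := fun h => hvz (hXw ▸ h |> Finset.mem_of_mem_erase)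
      have hnot : ∀ u, (u, v) ∉ reverse A ∪ A₁ := fun u hu =>
        hv u (Finset.mem_filter.2 ⟨hu, hvz'⟩)
      rw [mem_sources]
      refine ⟨by_contra fun hvt => ?_, fun u hu => hnot u (Finset.mem_union_left _ hu)⟩
      rw [← bagUnion_union (Nat.zero_le t) htz.le, Finset.mem_union] at hvU
      rcases ((ForcingRun.mem_iff hA₁ v).1 (hvU.resolve_left hvt)) with hvS | ⟨u, hu⟩
      · rcases Finset.mem_union.1 hvS with hvS | hvS
        · exact hvt (bag_subset_bagUnion (Nat.zero_le _) le_rfl hvS)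
        · exact hvz hvS
      · exact hnot u (Finset.mem_union_right _ hu)
    have h1 := Finset.card_le_card hsrc
    have h2 := Finset.card_union_le (sources (reverse A) (bagUnion X 0 t)) (X (z - 1))
    have h3 := hX.card_bag_le (i := z - 1) (by omega)
    have h4 := h.card_sources_le
    rw [hr₀.card_sources_reverse] at h2
    rw [Finset.card_insert_of_notMem hWF, mul_add, mul_one]
    omega

theorem PrefixInvariant.isZeroForcingSet (hX : IsNicePathDecomposition G k X) {t : ℕ}
    {A A₁ : Finset (V × V)} {F : Finset (Finset V)} (h : PrefixInvariant G k X t A F)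
    (hA₁ : A₁ ∈ forcingArcSets G (bagUnion X t (k + 1)) (X t)) :
    IsZeroForcingSet G (sources (reverse A) (bagUnion X 0 t)) := by
  obtain ⟨⟨r, hr⟩, hnew⟩ := h.exists_rank_union hX h.le_succ le_rfl subset_rfl
    (bag_subset_bagUnion le_rfl h.le_succ) hA₁
  -- The last segment is forced from `X t` alone, so it adds no source.
  have hsrc : sources (reverse A ∪ A₁) (bagUnion X 0 (k + 1)) =
      sources (reverse A) (bagUnion X 0 t) := by
    ext v
    simp only [mem_sources, ← bagUnion_union (Nat.zero_le t) h.le_succ, Finset.mem_union, not_or]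
    constructor
    · rintro ⟨hvU, hv⟩
      refine ⟨by_contra fun hvt => ?_, fun u => (hv u).1⟩
      rcases (ForcingRun.mem_iff hA₁ v).1 (hvU.resolve_left hvt) with hvS | ⟨u, hu⟩
      · exact hvt (bag_subset_bagUnion (Nat.zero_le _) le_rfl hvS)
      · exact (hv u).2 hu
    · rintro ⟨hvU, hv⟩
      exact ⟨Or.inl hvU, fun u => ⟨hv u, fun hu => hnew hu hvU⟩⟩
  have hrun := hr.forcingRun
  rw [hsrc, hX.bagUnion_eq_univ] at hrun
  exact (white_eq_empty_iff (Finset.subset_univ _)).2 ⟨_, hrun⟩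

/-! ### Correctness and termination of runs -/

/-- What holds in every configuration that occurs in a run. -/
def StateInvariant (G : SimpleGraph V) (k : ℕ) (X : ℕ → Finset V) (s : State V) : Prop :=
  match s.line with
  | .search => PrefixInvariant G k X s.t s.A s.F
  | .loop => PrefixInvariant G k X s.t s.A s.F ∧ SearchInvariant G k X s.t s.z s.W
  | .rev => PrefixInvariant G k X s.t s.A s.F ∧ SearchInvariant G k X s.t s.z s.W ∧
      (s.W = ∅ → s.z = k + 1)
  | .cases => ∃ A, PrefixInvariant G k X s.t A s.F ∧ SearchInvariant G k X s.t s.z s.W ∧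
      (s.W = ∅ → s.z = k + 1) ∧ s.A = reverse A ∧ s.S = sources (reverse A) (bagUnion X 0 s.t)
  | .halt => IsZeroForcingSet G s.S ∧ IsFortPacking G s.F ∧
      s.S.card ≤ ((Finset.Icc 1 k).sup fun i => (X i).card) * s.F.card

theorem StateInvariant.step (hX : IsNicePathDecomposition G k X) {s s' : State V}
    (h : StateInvariant G k X s) (hs : Step G k X s s') : StateInvariant G k X s' := by
  cases hs with
  | search t z W S A F => exact ⟨h, .start (PrefixInvariant.le_succ h)⟩
  | loop_body t z W S A F hW hz =>
    subst hW
    exact ⟨h.1, h.2.next hz⟩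
  | loop_exit t z W S A F hWz =>
    refine ⟨h.1, h.2, fun hW => ?_⟩
    have := h.2.le_succ
    have hz : ¬ z ≤ k := fun hz => hWz ⟨hW, hz⟩
    simp only at this ⊢
    omega
  | rev t z W S A F => exact ⟨A, h.1, h.2.1, h.2.2, rfl, rfl⟩
  | extend t z W S A F hW A₁ hA₁ =>
    obtain ⟨A₀, hp, hs, -, rfl, -⟩ := h
    exact hp.extend hX hs hW hA₁
  | finish t z W S A F hW A₁ hA₁ =>
    obtain ⟨A₀, hp, hs, hz, rfl, hS⟩ := h
    dsimp only at hS
    subst hS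
    obtain rfl := hz hW
    obtain ⟨r, hr⟩ := hp.exists_rank
    exact ⟨hp.isZeroForcingSet hX hA₁, hp.isFortPacking,
      hr.card_sources_reverse.trans_le hp.card_sources_le⟩

theorem StateInvariant.exists_step (hX : IsNicePathDecomposition G k X) {s : State V}
    (h : StateInvariant G k X s) (hs : s.line ≠ .halt) : ∃ s', Step G k X s s' := by
  obtain ⟨line, t, z, W, S, A, F⟩ := s
  cases line with
  | search => exact ⟨_, .search ..⟩
  | loop =>
    by_cases hWz : W = ∅ ∧ z ≤ k
    · exact ⟨_, .loop_body _ _ _ _ _ _ hWz.1 hWz.2⟩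
    · exact ⟨_, .loop_exit _ _ _ _ _ _ hWz⟩
  | rev => exact ⟨_, .rev ..⟩
  | cases =>
    obtain ⟨A₀, -, hsr, hz, -, -⟩ := h
    by_cases hW : W = ∅
    · obtain rfl := hz hW
      subst hW
      obtain ⟨A₁, hA₁⟩ := hsr.forcingArcSets_nonempty_of_eq_empty hX
      exact ⟨_, .finish _ _ _ _ _ _ rfl A₁ hA₁⟩
    · obtain ⟨A₁, hA₁⟩ := hsr.forcingArcSets_nonempty hX hW
      exact ⟨_, .extend _ _ _ _ _ _ hW A₁ hA₁⟩
  | halt => exact absurd rfl hs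

/-- A bound for the number of remaining steps. -/
def remaining (k : ℕ) (s : State V) : ℕ :=
  match s.line with
  | .search => (k + 1 - s.t) * (k + 5) + (k + 1 - s.t) + 4
  | .loop => (k + 1 - s.t) * (k + 5) + (k + 1 - s.z) + 3
  | .rev => (k + 1 - s.t) * (k + 5) + 2
  | .cases => (k + 1 - s.t) * (k + 5) + 1
  | .halt => 0

theorem StateInvariant.remaining_lt (hX : IsNicePathDecomposition G k X) {s s' : State V}
    (h : StateInvariant G k X s) (hs : Step G k X s s') : remaining k s' < remaining k s := by
  cases hs with
  | search t z W S A F => simp only [remaining]; omega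
  | loop_body t z W S A F hW hz => simp only [remaining]; omega
  | loop_exit t z W S A F hWz => simp only [remaining]; omega
  | rev t z W S A F => simp only [remaining]; omega
  | extend t z W S A F hW A₁ hA₁ =>
    obtain ⟨A₀, -, hsr, -⟩ := h
    have htz := (hsr.exists_erase hX hW).1
    have hz := hsr.le_succ
    simp only [remaining] at htz hz ⊢
    -- Since `t < z`, the product drops by at least `k + 5`, which pays for the search restarted at
    -- `z`.
    have hle : (k + 1 - z + 1) * (k + 5) ≤ (k + 1 - t) * (k + 5) :=
      Nat.mul_le_mul_right _ (by omega)
    rw [Nat.add_mul, Nat.one_mul] at hle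
    omega
  | finish t z W S A F hW A₁ hA₁ => simp only [remaining]; omega

theorem StateInvariant.of_reachable (hX : IsNicePathDecomposition G k X) {s : State V}
    (h : Reachable G k X s) : StateInvariant G k X s := by
  induction h with
  | refl => exact PrefixInvariant.start hX
  | tail _ hs ih => exact ih.step hX hs

theorem IsNicePathDecomposition.alwaysHalts (hX : IsNicePathDecomposition G k X) :
    AlwaysHalts G k X := by
  refine ⟨?_, fun s hs => (StateInvariant.of_reachable hX hs).exists_step hX⟩
  rintro ⟨r, h0, hr⟩
  have hreach : ∀ n, Reachable G k X (r n) := by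
    intro n
    induction n with
    | zero => rw [h0]; exact .refl
    | succ n ih => exact ih.tail (hr n)
  have hbound : ∀ n, remaining k (r n) + n ≤ remaining k (r 0) := by
    intro n
    induction n with
    | zero => rfl
    | succ n ih =>
      have := (StateInvariant.of_reachable hX (hreach n)).remaining_lt hX (hr n)
      omega
  have := hbound (remaining k (r 0) + 1)
  omega

end ZeroForcing

theorem mainTheorem3 {V : Type*} [Fintype V] [DecidableEq V] (G : SimpleGraph V)
    (k : ℕ) (X : ℕ → Finset V) (hX : ZeroForcing.IsNicePathDecomposition G k X) :
    ZeroForcing.AlwaysHalts G k X ∧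
    ∀ (S : Finset V) (F : Finset (Finset V)), ZeroForcing.Returns G k X S F →
      ZeroForcing.IsZeroForcingSet G S ∧
      ZeroForcing.IsFortPacking G F ∧
      (S.card : ℤ) ≤ (ZeroForcing.width k X + 1) * (F.card : ℤ) ∧
      (ZeroForcing.width k X = ZeroForcing.pathwidth G →
        (S.card : ℤ) ≤ (ZeroForcing.pathwidth G + 1) * (ZeroForcing.zeroForcingNumber G : ℤ)) := by
  refine ⟨hX.alwaysHalts, ?_⟩
  rintro S F ⟨⟨line, t, z, W, S', A, F'⟩, hs, rfl, rfl, rfl⟩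
  obtain ⟨hS, hF, hc⟩ := ZeroForcing.StateInvariant.of_reachable hX hs
  have hw : ((S'.card : ℕ) : ℤ) ≤ (ZeroForcing.width k X + 1) * (F'.card : ℤ) := by
    rw [ZeroForcing.width, sub_add_cancel]
    exact_mod_cast hc
  refine ⟨hS, hF, hw, fun hpw => ?_⟩
  rw [← hpw]
  refine hw.trans (mul_le_mul_of_nonneg_left ?_ ?_)
  · exact_mod_cast hF.card_le_zeroForcingNumber
  · rw [ZeroForcing.width, sub_add_cancel]
    exact Int.natCast_nonneg _
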